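/- Let $K$ be a field, let $n_1,\dots,n_4$ be pairwise distinct positive integers with $\gcd(n_1,\dots,n_4)=1$, and let $I(C)\subset K[x_1,\dots,x_4]$ be the toric ideal of the monomial curve $C$, that is, the kernel of the $K$-algebra homomorphism $K[x_1,\dots,x_4]\to K[t]$, $x_i\mapsto t^{n_i}$. Let $a_{13},a_{14},a_{21},a_{23},a_{32},a_{34},a_{41},a_{42}$ be positive integers, put $$a_1=a_{21}+a_{41},\quad a_2=a_{32}+a_{42},\quad a_3=a_{13}+a_{23},\quad a_4=a_{14}+a_{34},$$ and suppose that $I(C)$ is generated by $G=\{f_1,\dots,f_5\}$, where $$f_1=x_3^{a_{13}}x_4^{a_{14}}-x_1^{a_1},\quad f_2=x_2^{a_2}-x_1^{a_{21}}x_3^{a_{23}},\quad f_3=x_3^{a_3}-x_2^{a_{32}}x_4^{a_{34}},$$ $$f_4=x_4^{a_4}-x_1^{a_{41}}x_2^{a_{42}},\quad f_5=x_2^{a_{42}}x_3^{a_{13}}-x_1^{a_{21}}x_4^{a_{34}}$$ (by a theorem of Bresinsky this is the case, after renumbering the variables, whenever $C$ is Gorenstein and not a complete intersection). Let $d$ be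 the minimum of $\{i\in\mathbb N: a_2-ia_{32}\le 0\}\cup\{i\in\mathbb N: a_4-ia_{34}\le 0\}$; then $d\ge 2$. For $0\le i\le d-2$ put $$g_i=x_2^{a_2-(i+1)a_{32}}x_3^{ia_3+a_{13}}-x_1^{a_{21}}x_4^{(i+1)a_{34}},\qquad h_i=x_3^{ia_3+a_{13}}x_4^{a_4-(i+1)a_{34}}-x_1^{a_1}x_2^{ia_{32}},$$ and let $$p=\begin{cases}x_3^{(d-1)a_3+a_{13}}-x_1^{a_{21}}x_2^{da_{32}-a_2}x_4^{da_{34}}, & \text{if } a_4-da_{34}>0,\\ x_3^{(d-1)a_3+a_{13}}-x_1^{a_1}x_2^{(d-1)a_{32}}x_4^{da_{34}-a_4}, & \text{if } a_4-da_{34}\le 0.\end{cases}$$ Suppose that $n_1=\min\{n_1,\dots,n_4\}$, that $a_3>a_{32}+a_{34}$, and that 1. $a_2\le a_{21}+a_{23}$; 2. $a_4\le a_{41}+a_{42}$; 3. $a_{42}+a_{13}\le a_{21}+a_{34}$; 4. $(d-1)(a_3-a_{32}-a_{34})+a_2-a_{21}-a_{23}\le 0$; 5. $(d-1)(a_3-a_{32}-a_{34})+a_4+a_{32}-a_1-a_{23}\le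 0$; 6. $d(a_3-a_{32}-a_{34})+a_2-a_{21}-a_{23}\le 0$ when $a_4-da_{34}>0$; 7. $d(a_3-a_{32}-a_{34})+a_4+a_{32}-a_1-a_{23}\le 0$ when $a_4-da_{34}\le 0$. Then $$T=G\cup\{g_i: 1\le i\le d-2\}\cup\{h_i: 1\le i\le d-2\}\cup\{p\}$$ is a minimal standard basis of $I(C)$ with respect to the negative degree reverse lexicographic ordering with $x_4>x_3>x_2>x_1$: $T$ is a finite subset of $I(C)$ not containing $0$, the leading monomials of the elements of $T$ generate the same ideal as the leading monomials of all nonzero elements of $I(C)$, and for distinct $f,g\in T$ the leading monomial of $g$ does not divide that of $f$. (Here $x^\alpha<x^\beta$ if and only if $\deg x^\alpha>\deg x^\beta$, or the degrees are equal and, for the least $i$ with $\alpha_i\ne\beta_i$, one has $\alpha_i>\beta_i$.) -/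

import Mathlib

/-- The toric ideal `I(C)` of the monomial curve `C` in affine `r`-space given parametrically by
`x_i = t ^ n_i`: the kernel of the `K`-algebra homomorphism `K[x_1, …, x_r] → K[t]`,
`x_i ↦ t ^ n_i`. -/
noncomputable def toricIdeal (K : Type*) [Field K] {r : ℕ} (n : Fin r → ℕ) :
    Ideal (MvPolynomial (Fin r) K) :=
  RingHom.ker
    (MvPolynomial.aeval (fun i => (Polynomial.X : Polynomial K) ^ n i) :
      MvPolynomial (Fin r) K →ₐ[K] Polynomial K)

/-- The (local) negative degree reverse lexicographic ordering on exponent vectors, for which the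
variable with the largest index is the largest one (so `x_r > ⋯ > x_2 > x_1`):
`NegDegRevLex α β` means `x^α < x^β`, i.e. `deg α > deg β`, or the degrees agree and, at the first
index (counted from the lowest variable) where `α` and `β` differ, `α` has the larger exponent. -/
def NegDegRevLex {r : ℕ} (α β : Fin r →₀ ℕ) : Prop :=
  β.degree < α.degree ∨
    (α.degree = β.degree ∧ ∃ i, (∀ j, j < i → α j = β j) ∧ β i < α i)

section StandardBasis

variable {K : Type*} [Field K] {σ : Type*}

/-- `x^m` is the leading monomial of `f` with respect to the strict monomial ordering `lt`.
(There is none for `f = 0`.) -/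
def IsLeadingMonomial (lt : (σ →₀ ℕ) → (σ →₀ ℕ) → Prop) (f : MvPolynomial σ K) (m : σ →₀ ℕ) :
    Prop :=
  m ∈ f.support ∧ ∀ m' ∈ f.support, m' ≠ m → lt m' m

/-- The leading ideal `L(S)`: the ideal generated by the leading monomials of the (nonzero)
elements of `S`. -/
noncomputable def leadingIdeal (lt : (σ →₀ ℕ) → (σ →₀ ℕ) → Prop) (S : Set (MvPolynomial σ K)) :
    Ideal (MvPolynomial σ K) :=
  Ideal.span {q | ∃ f ∈ S, ∃ m, IsLeadingMonomial lt f m ∧ q = MvPolynomial.monomial m 1}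

/-- `T` is a standard basis of `I`: a finite subset of `I` with `L(T) = L(I)`. -/
def IsStandardBasis (lt : (σ →₀ ℕ) → (σ →₀ ℕ) → Prop) (I : Ideal (MvPolynomial σ K))
    (T : Set (MvPolynomial σ K)) : Prop :=
  T.Finite ∧ T ⊆ (I : Set (MvPolynomial σ K)) ∧
    leadingIdeal lt T = leadingIdeal lt (I : Set (MvPolynomial σ K))

/-- `T` is a minimal standard basis of `I`: a standard basis with `0 ∉ T` in which no leading
monomial divides the leading monomial of another element. -/
def IsMinimalStandardBasis (lt : (σ →₀ ℕ) → (σ →₀ ℕ) → Prop) (I : Ideal (MvPolynomial σ K))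
    (T : Set (MvPolynomial σ K)) : Prop :=
  IsStandardBasis lt I T ∧ (0 : MvPolynomial σ K) ∉ T ∧
    ∀ f ∈ T, ∀ g ∈ T, f ≠ g → ∀ m m', IsLeadingMonomial lt f m → IsLeadingMonomial lt g m' →
      ¬ (MvPolynomial.monomial m' (1 : K) ∣ MvPolynomial.monomial m 1)

end StandardBasis

/-- The positive exponents `a_{ij}` occurring in the five binomials `f_1, …, f_5` below. -/
structure CurveExponents where
  (a13 a14 a21 a23 a32 a34 a41 a42 : ℕ)
  a13_pos : 0 < a13
  a14_pos : 0 < a14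
  a21_pos : 0 < a21
  a23_pos : 0 < a23
  a32_pos : 0 < a32
  a34_pos : 0 < a34
  a41_pos : 0 < a41
  a42_pos : 0 < a42

namespace CurveExponents

variable (a : CurveExponents)

/-- `a_1 = a_21 + a_41` -/
def a1 : ℕ := a.a21 + a.a41

/-- `a_2 = a_32 + a_42` -/
def a2 : ℕ := a.a32 + a.a42

/-- `a_3 = a_13 + a_23` -/
def a3 : ℕ := a.a13 + a.a23

/-- `a_4 = a_14 + a_34` -/
def a4 : ℕ := a.a14 + a.a34

/-- `d = min ({i | a_2 - i a_32 ≤ 0} ∪ {i | a_4 - i a_34 ≤ 0})`; the set is nonempty because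
`a_32` and `a_34` are positive. -/
noncomputable def d : ℕ :=
  sInf ({i : ℕ | (a.a2 : ℤ) - i * a.a32 ≤ 0} ∪ {i : ℕ | (a.a4 : ℤ) - i * a.a34 ≤ 0})

variable (K : Type*) [Field K]

open MvPolynomial

-- The variables `x_1, x_2, x_3, x_4` are `X 0, X 1, X 2, X 3`.

/-- `f_1 = x_3^{a_13} x_4^{a_14} - x_1^{a_1}` -/
noncomputable def f1 : MvPolynomial (Fin 4) K :=
  X 2 ^ a.a13 * X 3 ^ a.a14 - X 0 ^ a.a1

/-- `f_2 = x_2^{a_2} - x_1^{a_21} x_3^{a_23}` -/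
noncomputable def f2 : MvPolynomial (Fin 4) K :=
  X 1 ^ a.a2 - X 0 ^ a.a21 * X 2 ^ a.a23

/-- `f_3 = x_3^{a_3} - x_2^{a_32} x_4^{a_34}` -/
noncomputable def f3 : MvPolynomial (Fin 4) K :=
  X 2 ^ a.a3 - X 1 ^ a.a32 * X 3 ^ a.a34

/-- `f_4 = x_4^{a_4} - x_1^{a_41} x_2^{a_42}` -/
noncomputable def f4 : MvPolynomial (Fin 4) K :=
  X 3 ^ a.a4 - X 0 ^ a.a41 * X 1 ^ a.a42

/-- `f_5 = x_2^{a_42} x_3^{a_13} - x_1^{a_21} x_4^{a_34}` -/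
noncomputable def f5 : MvPolynomial (Fin 4) K :=
  X 1 ^ a.a42 * X 2 ^ a.a13 - X 0 ^ a.a21 * X 3 ^ a.a34

/-- `G = {f_1, …, f_5}` -/
noncomputable def G : Set (MvPolynomial (Fin 4) K) :=
  {a.f1 K, a.f2 K, a.f3 K, a.f4 K, a.f5 K}

/-- `g_i = x_2^{a_2 - (i+1) a_32} x_3^{i a_3 + a_13} - x_1^{a_21} x_4^{(i+1) a_34}`, used only for
`i ≤ d - 2`, where `a_2 - (i+1) a_32 > 0`. -/
noncomputable def g (i : ℕ) : MvPolynomial (Fin 4) K :=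
  X 1 ^ (a.a2 - (i + 1) * a.a32) * X 2 ^ (i * a.a3 + a.a13) -
    X 0 ^ a.a21 * X 3 ^ ((i + 1) * a.a34)

/-- `h_i = x_3^{i a_3 + a_13} x_4^{a_4 - (i+1) a_34} - x_1^{a_1} x_2^{i a_32}`, used only for
`i ≤ d - 2`, where `a_4 - (i+1) a_34 > 0`. -/
noncomputable def h (i : ℕ) : MvPolynomial (Fin 4) K :=
  X 2 ^ (i * a.a3 + a.a13) * X 3 ^ (a.a4 - (i + 1) * a.a34) -
    X 0 ^ a.a1 * X 1 ^ (i * a.a32)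

/-- The binomial `p`; the case distinction is `a_4 - d a_34 > 0` or `a_4 - d a_34 ≤ 0`. In the
first case `d a_32 - a_2 ≥ 0` by the definition of `d`, in the second `d a_34 - a_4 ≥ 0`, and
`d ≥ 2` always, so none of the subtractions truncates. -/
noncomputable def p : MvPolynomial (Fin 4) K :=
  if 0 < (a.a4 : ℤ) - a.d * a.a34 then
    X 2 ^ ((a.d - 1) * a.a3 + a.a13) -
      X 0 ^ a.a21 * X 1 ^ (a.d * a.a32 - a.a2) * X 3 ^ (a.d * a.a34)
  else
    X 2 ^ ((a.d - 1) * a.a3 + a.a13) -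
      X 0 ^ a.a1 * X 1 ^ ((a.d - 1) * a.a32) * X 3 ^ (a.d * a.a34 - a.a4)

/-- `T = G ∪ {g_i | 1 ≤ i ≤ d - 2} ∪ {h_i | 1 ≤ i ≤ d - 2} ∪ {p}` -/
noncomputable def T : Set (MvPolynomial (Fin 4) K) :=
  a.G K ∪ {q | ∃ i, 1 ≤ i ∧ i ≤ a.d - 2 ∧ q = a.g K i} ∪
    {q | ∃ i, 1 ≤ i ∧ i ≤ a.d - 2 ∧ q = a.h K i} ∪ {a.p K}

end CurveExponents

/-! No S-polynomials are reduced. Call a monomial normal if no leading monomial of `T` divides it.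
The claim is that two normal monomials of equal weight coincide (`IsRule.eq_of_forall_not_le`).

This suffices (`leadingIdeal_toricIdeal_le`). If the leading monomial `m` of some `f ∈ I(C)` were
normal, another monomial of `f` would have the same weight and lie below `m`. Since the `n_i` are
positive, a weight class is finite, so it has a least element below `m` although the order is local.
That element is normal, because rewriting by a binomial of `T` keeps the weight and goes down; it
must then equal `m`, a contradiction.

For the claim, `u - v` lies in the lattice spanned by the exponent differences of `f_2`, `f_3`,
`f_4`, since `G` generates `I(C)`. With coefficients `α, β, γ`, normality forces `β ≤ 0`, by
symmetry `β = 0`, and then `γ = α = 0`. The numerical conditions serve only to identify the leading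
monomials. -/

/-! ### The local monomial order. -/

section NegDegRevLex

variable {r : ℕ}

theorem NegDegRevLex.irrefl (α : Fin r →₀ ℕ) : ¬ NegDegRevLex α α := by
  rintro (h | ⟨-, i, -, h⟩) <;> exact lt_irrefl _ h

theorem NegDegRevLex.trans {α β γ : Fin r →₀ ℕ} (h₁ : NegDegRevLex α β)
    (h₂ : NegDegRevLex β γ) : NegDegRevLex α γ := by
  rcases h₁ with h₁ | ⟨e₁, i, hi, hi'⟩ <;> rcases h₂ with h₂ | ⟨e₂, j, hj, hj'⟩
  · exact Or.inl (h₂.trans h₁)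
  · exact Or.inl (e₂ ▸ h₁)
  · exact Or.inl (e₁ ▸ h₂)
  · refine Or.inr ⟨e₁.trans e₂, ?_⟩
    rcases lt_trichotomy i j with h | h | h
    · exact ⟨i, fun k hk => (hi k hk).trans (hj k (hk.trans h)), by rw [← hj i h]; exact hi'⟩
    · subst h
      exact ⟨i, fun k hk => (hi k hk).trans (hj k hk), hj'.trans hi'⟩
    · exact ⟨j, fun k hk => (hi k (hk.trans h)).trans (hj k hk), by rw [hi j h]; exact hj'⟩

theorem NegDegRevLex.add_left {α β : Fin r →₀ ℕ} (γ : Fin r →₀ ℕ) (h : NegDegRevLex α β) :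
    NegDegRevLex (γ + α) (γ + β) := by
  rcases h with h | ⟨e, i, hi, hi'⟩
  · exact Or.inl (by simpa using h)
  · exact Or.inr ⟨by simpa using e, i, fun j hj => by simp [hi j hj], by simpa using hi'⟩

end NegDegRevLex

/-! ### Toric ideals, normal monomials and relation lattices. -/

section Toric

open MvPolynomial

variable {K : Type*} [Field K] {r : ℕ}

theorem aeval_X_pow_monomial (n : Fin r → ℕ) (α : Fin r →₀ ℕ) (c : K) :
    (aeval (fun i => (Polynomial.X : Polynomial K) ^ n i) : MvPolynomial (Fin r) K →ₐ[K] _)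
      (monomial α c) = Polynomial.monomial (Finsupp.weight n α) c := by
  rw [aeval_monomial, Finsupp.weight_apply, ← Polynomial.C_mul_X_pow_eq_monomial,
    Polynomial.algebraMap_eq, Finsupp.prod, Finsupp.sum, ← Finset.prod_pow_eq_pow_sum]
  congr 1
  refine Finset.prod_congr rfl fun i _ => ?_
  rw [← pow_mul, smul_eq_mul, mul_comm]

theorem binomial_mem_toricIdeal_iff (n : Fin r → ℕ) (α β : Fin r →₀ ℕ) :
    (monomial α 1 - monomial β 1 : MvPolynomial (Fin r) K) ∈ toricIdeal K n ↔
      Finsupp.weight n α = Finsupp.weight n β := by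
  rw [toricIdeal, RingHom.mem_ker, map_sub, sub_eq_zero, aeval_X_pow_monomial,
    aeval_X_pow_monomial]
  exact Polynomial.monomial_left_inj one_ne_zero

/-- Otherwise the coefficient of `m` would survive as a coefficient of the image of `f` in `K[t]`.
-/
theorem exists_ne_mem_support_of_mem_toricIdeal {n : Fin r → ℕ} {f : MvPolynomial (Fin r) K}
    (hf : f ∈ toricIdeal K n) {m : Fin r →₀ ℕ} (hm : m ∈ f.support) :
    ∃ m' ∈ f.support, m' ≠ m ∧ Finsupp.weight n m' = Finsupp.weight n m := by
  by_contra! H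
  rw [toricIdeal, RingHom.mem_ker, f.as_sum, map_sum] at hf
  have h := congrArg (fun q => Polynomial.coeff q (Finsupp.weight n m)) hf
  simp only [aeval_X_pow_monomial, Polynomial.finsetSum_coeff, Polynomial.coeff_monomial,
    Polynomial.coeff_zero] at h
  rw [Finset.sum_eq_single_of_mem m hm fun b hb hbm => if_neg (H b hb hbm), if_pos rfl] at h
  exact mem_support_iff.1 hm h

theorem finite_setOf_weight_eq {n : Fin r → ℕ} (n_pos : ∀ i, 0 < n i) (s : ℕ) :
    {α : Fin r →₀ ℕ | Finsupp.weight n α = s}.Finite := by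
  refine (Set.finite_Iic (Finsupp.equivFunOnFinite.symm fun _ : Fin r => s)).subset fun α hα i => ?_
  exact (Finsupp.le_weight n (n_pos i).ne' α).trans (le_of_eq hα)

theorem isLeadingMonomial_binomial_iff {α β m : Fin r →₀ ℕ} (h : NegDegRevLex β α) :
    IsLeadingMonomial NegDegRevLex (monomial α 1 - monomial β 1 : MvPolynomial (Fin r) K) m ↔
      m = α := by
  have hne : α ≠ β := by
    rintro rfl
    exact NegDegRevLex.irrefl _ h
  have hα : α ∈ (monomial α 1 - monomial β 1 : MvPolynomial (Fin r) K).support := by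
    simp [hne.symm]
  have hs : ∀ k ∈ (monomial α 1 - monomial β 1 : MvPolynomial (Fin r) K).support,
      k = α ∨ k = β := by
    intro k hk
    by_contra! hc
    simp [coeff_monomial, hc.1.symm, hc.2.symm] at hk
  constructor
  · rintro ⟨h₁, h₂⟩
    rcases hs m h₁ with rfl | rfl
    · rfl
    · exact absurd (h.trans (h₂ α hα hne)) (NegDegRevLex.irrefl _)
  · rintro rfl
    exact ⟨hα, fun k hk hkm => ((hs k hk).resolve_left hkm) ▸ h⟩

/-- If every monomial of a given weight but one is divisible by the larger monomial of a binomial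
`x^α - x^β` with `R α β`, then these larger monomials generate the leading ideal of the toric
ideal. -/
theorem leadingIdeal_toricIdeal_le {n : Fin r → ℕ} (n_pos : ∀ i, 0 < n i)
    {R : (Fin r →₀ ℕ) → (Fin r →₀ ℕ) → Prop} {T : Set (MvPolynomial (Fin r) K)}
    (hT : ∀ α β, R α β → ∃ q ∈ T, IsLeadingMonomial NegDegRevLex q α) (hlt : ∀ α β, R α β → NegDegRevLex β α)
    (hw : ∀ α β, R α β → Finsupp.weight n α = Finsupp.weight n β)
    (huniq : ∀ u v, Finsupp.weight n u = Finsupp.weight n v → (∀ α β, R α β → ¬ α ≤ u) →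
      (∀ α β, R α β → ¬ α ≤ v) → u = v) :
    leadingIdeal NegDegRevLex (toricIdeal K n : Set (MvPolynomial (Fin r) K)) ≤
      leadingIdeal NegDegRevLex T := by
  refine Ideal.span_le.2 ?_
  rintro _ ⟨f, hf, m, hm, rfl⟩
  suffices h : ∃ α β, R α β ∧ α ≤ m by
    obtain ⟨α, β, hR, hle⟩ := h
    have : (monomial m 1 : MvPolynomial (Fin r) K) = monomial (m - α) 1 * monomial α 1 := by
      rw [monomial_mul, one_mul, tsub_add_cancel_of_le hle]
    rw [this]
    obtain ⟨q, hq, hqα⟩ := hT α β hR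
    exact Ideal.mul_mem_left _ _ (Ideal.subset_span ⟨q, hq, α, hqα, rfl⟩)
  by_contra! hnorm
  obtain ⟨m', hm', hne, hwm⟩ := exists_ne_mem_support_of_mem_toricIdeal hf hm.1
  have hfin : {x : Fin r →₀ ℕ | Finsupp.weight n x = Finsupp.weight n m ∧
      NegDegRevLex x m}.Finite :=
    (finite_setOf_weight_eq n_pos _).subset fun x hx => hx.1
  let : IsStrictOrder (Fin r →₀ ℕ) NegDegRevLex :=
    { irrefl := NegDegRevLex.irrefl
      trans := fun _ _ _ => NegDegRevLex.trans }
  -- The order is not well-founded, but it is on a finite set. The least `x` is normal, since a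
  -- rewriting step would give a smaller monomial of the same weight.
  obtain ⟨⟨x, hx, hxm⟩, -, hmin⟩ := WellFounded.has_min (hfin.wellFoundedOn (r := NegDegRevLex))
    Set.univ ⟨⟨m', hwm, hm.2 m' hm' hne⟩, trivial⟩
  refine NegDegRevLex.irrefl m ((huniq x m hx ?_ hnorm) ▸ hxm)
  intro α β hR hle
  have hlt' : NegDegRevLex (x - α + β) x := by
    have h := NegDegRevLex.add_left (x - α) (hlt α β hR)
    rwa [tsub_add_cancel_of_le hle] at h
  have hw' : Finsupp.weight n (x - α + β) = Finsupp.weight n x := by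
    rw [map_add, ← hw α β hR, ← map_add, tsub_add_cancel_of_le hle]
  exact hmin ⟨x - α + β, hw'.trans hx, hlt'.trans hxm⟩ trivial hlt'

/-- If binomials generate the toric ideal, their exponent differences generate the lattice of
relations among the weights. -/
theorem sub_mem_of_weight_eq {n : Fin r → ℕ} {S : Set (MvPolynomial (Fin r) K)}
    (hS : toricIdeal K n = Ideal.span S) (L : AddSubgroup (Fin r → ℤ))
    (hL : ∀ q ∈ S, ∃ α β : Fin r →₀ ℕ, (fun i => (α i : ℤ) - β i) ∈ L ∧
      q = monomial α 1 - monomial β 1)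
    {u v : Fin r →₀ ℕ} (huv : Finsupp.weight n u = Finsupp.weight n v) :
    (fun i => (u i : ℤ) - v i) ∈ L := by
  -- Grading by `ℤ^r / L` gives a map to the group algebra of the quotient that kills every
  -- generator. It therefore kills `x^u - x^v`, which puts `u` and `v` in the same class.
  let c : (Fin r →₀ ℕ) →+ (Fin r → ℤ) ⧸ L := (QuotientAddGroup.mk' L).comp
    { toFun := fun α i => (α i : ℤ)
      map_zero' := by ext; simp
      map_add' := fun α β => by ext; simp }
  let φ : MvPolynomial (Fin r) K →+* AddMonoidAlgebra K ((Fin r → ℤ) ⧸ L) :=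
    AddMonoidAlgebra.mapDomainRingHom K c
  have hφ : ∀ α : Fin r →₀ ℕ, φ (monomial α 1) = AddMonoidAlgebra.single (c α) 1 := fun α =>
    AddMonoidAlgebra.mapDomain_single
  have hc : ∀ α β : Fin r →₀ ℕ, c α = c β ↔ (fun i => (α i : ℤ) - β i) ∈ L := fun α β => by
    rw [← sub_eq_zero]
    exact QuotientAddGroup.eq_zero_iff (N := L) (fun i => (α i : ℤ) - β i)
  have hle : Ideal.span S ≤ RingHom.ker φ := Ideal.span_le.2 fun q hq => by
    obtain ⟨α, β, hαβ, rfl⟩ := hL q hq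
    simp only [SetLike.mem_coe, RingHom.mem_ker, map_sub, hφ, (hc α β).2 hαβ, sub_self]
  have h := hle (hS ▸ (binomial_mem_toricIdeal_iff n u v).2 huv)
  rw [RingHom.mem_ker, map_sub, sub_eq_zero, hφ, hφ] at h
  exact (hc u v).1 (AddMonoidAlgebra.of_injective (R := K) h)

end Toric

/-! ### Exponent vectors in four variables. -/

/-- The exponent vector `(b, c, d, e)`. -/
noncomputable def expVec (b c d e : ℕ) : Fin 4 →₀ ℕ :=
  Finsupp.equivFunOnFinite.symm ![b, c, d, e]

section expVec

variable (b c d e : ℕ)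

@[simp] theorem expVec_zero : expVec b c d e 0 = b := rfl
@[simp] theorem expVec_one : expVec b c d e 1 = c := rfl
@[simp] theorem expVec_two : expVec b c d e 2 = d := rfl
@[simp] theorem expVec_three : expVec b c d e 3 = e := rfl

theorem expVec_le_iff (u : Fin 4 →₀ ℕ) :
    expVec b c d e ≤ u ↔ b ≤ u 0 ∧ c ≤ u 1 ∧ d ≤ u 2 ∧ e ≤ u 3 := by
  rw [Finsupp.le_def, Fin.forall_fin_succ, Fin.forall_fin_succ, Fin.forall_fin_succ,
    Fin.forall_fin_one]
  rfl

theorem weight_expVec (n : Fin 4 → ℕ) :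
    Finsupp.weight n (expVec b c d e) = b * n 0 + c * n 1 + d * n 2 + e * n 3 := by
  rw [Finsupp.weight_apply, Finsupp.sum_fintype _ _ (by simp), Fin.sum_univ_four]
  rfl

theorem monomial_expVec (K : Type*) [Field K] :
    (MvPolynomial.monomial (expVec b c d e) 1 : MvPolynomial (Fin 4) K) =
      MvPolynomial.X 0 ^ b * MvPolynomial.X 1 ^ c * MvPolynomial.X 2 ^ d *
        MvPolynomial.X 3 ^ e := by
  rw [MvPolynomial.monomial_eq, map_one, one_mul, Finsupp.prod_fintype _ _ (by simp),
    Fin.prod_univ_four]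
  rfl

variable {b c d e}

/-- `x_1` is compared first, so a tie in degree is decided by its exponent. -/
theorem negDegRevLex_expVec {b' c' d' e' : ℕ} (h : b' + c' + d' + e' ≤ b + c + d + e)
    (hb : b' < b) : NegDegRevLex (expVec b c d e) (expVec b' c' d' e') := by
  simp only [NegDegRevLex, Finsupp.degree_eq_sum, Fin.sum_univ_four, expVec_zero, expVec_one,
    expVec_two, expVec_three]
  rcases h.lt_or_eq with h | h
  · exact Or.inl h
  · exact Or.inr ⟨h.symm, 0, fun j hj => absurd hj (Fin.not_lt_zero j), hb⟩

theorem negDegRevLex_expVec_of_lt {b' c' d' e' : ℕ}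
    (h : b' + c' + d' + e' < b + c + d + e) :
    NegDegRevLex (expVec b c d e) (expVec b' c' d' e') := by
  left
  simpa only [Finsupp.degree_eq_sum, Fin.sum_univ_four, expVec_zero, expVec_one,
    expVec_two, expVec_three] using h

end expVec

/-! ### The number `d` and the rewriting rules. -/

namespace CurveExponents

variable (a : CurveExponents)

theorem d_mem : a.a2 ≤ a.d * a.a32 ∨ a.a4 ≤ a.d * a.a34 := by
  have hne : ({i : ℕ | (a.a2 : ℤ) - i * a.a32 ≤ 0} ∪
      {i : ℕ | (a.a4 : ℤ) - i * a.a34 ≤ 0}).Nonempty := by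
    refine ⟨a.a2, Or.inl ?_⟩
    have := a.a32_pos
    simp only [Set.mem_ofPred_eq]
    nlinarith
  have hm : a.d ∈ _ := Nat.sInf_mem hne
  rcases hm with h | h <;> simp only [Set.mem_ofPred_eq, sub_nonpos] at h
  · exact Or.inl (by exact_mod_cast h)
  · exact Or.inr (by exact_mod_cast h)

theorem mul_lt_of_lt_d {i : ℕ} (hi : i < a.d) : i * a.a32 < a.a2 ∧ i * a.a34 < a.a4 := by
  have h := Nat.notMem_of_lt_sInf hi
  simp only [Set.mem_union, Set.mem_ofPred_eq, sub_nonpos, not_or, not_le] at h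
  exact ⟨by exact_mod_cast h.1, by exact_mod_cast h.2⟩

theorem two_le_d : 2 ≤ a.d := by
  by_contra! h
  have h1 := a.a42_pos
  have h2 := a.a14_pos
  have h3 := a.a32_pos
  have h4 := a.a34_pos
  have := a.d_mem
  rw [a2, a4] at this
  interval_cases a.d <;> omega

/-- `a.IsRule u v` says that `x^u - x^v` belongs to `T`, with `u` the leading exponent; here
`f_1 = h_0` and `f_5 = g_0`. -/
inductive IsRule : (Fin 4 →₀ ℕ) → (Fin 4 →₀ ℕ) → Prop
  | f2 : IsRule (expVec 0 a.a2 0 0) (expVec a.a21 0 a.a23 0)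
  | f3 : IsRule (expVec 0 a.a32 0 a.a34) (expVec 0 0 a.a3 0)
  | f4 : IsRule (expVec 0 0 0 a.a4) (expVec a.a41 a.a42 0 0)
  | g (i : ℕ) (hi : i ≤ a.d - 2) :
      IsRule (expVec 0 (a.a2 - (i + 1) * a.a32) (i * a.a3 + a.a13) 0)
        (expVec a.a21 0 0 ((i + 1) * a.a34))
  | h (i : ℕ) (hi : i ≤ a.d - 2) :
      IsRule (expVec 0 0 (i * a.a3 + a.a13) (a.a4 - (i + 1) * a.a34))
        (expVec a.a1 (i * a.a32) 0 0)
  | p_of_lt (hd : a.d * a.a34 < a.a4) :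
      IsRule (expVec 0 0 ((a.d - 1) * a.a3 + a.a13) 0)
        (expVec a.a21 (a.d * a.a32 - a.a2) 0 (a.d * a.a34))
  | p_of_le (hd : a.a4 ≤ a.d * a.a34) :
      IsRule (expVec 0 0 ((a.d - 1) * a.a3 + a.a13) 0)
        (expVec a.a1 ((a.d - 1) * a.a32) 0 (a.d * a.a34 - a.a4))

/-! ### Leading exponents, their incomparability, and uniqueness of normal monomials. -/

section Lead

variable {a}

theorem IsRule.negDegRevLex (h3 : a.a3 > a.a32 + a.a34)
    (c1 : a.a2 ≤ a.a21 + a.a23)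
    (c2 : a.a4 ≤ a.a41 + a.a42)
    (c4 : ((a.d : ℤ) - 1) * (a.a3 - a.a32 - a.a34) + a.a2 - a.a21 - a.a23 ≤ 0)
    (c5 : ((a.d : ℤ) - 1) * (a.a3 - a.a32 - a.a34) + a.a4 + a.a32 - a.a1 - a.a23 ≤ 0)
    (c6 : (a.a4 : ℤ) - a.d * a.a34 > 0 →
      (a.d : ℤ) * (a.a3 - a.a32 - a.a34) + a.a2 - a.a21 - a.a23 ≤ 0)
    (c7 : (a.a4 : ℤ) - a.d * a.a34 ≤ 0 →
      (a.d : ℤ) * (a.a3 - a.a32 - a.a34) + a.a4 + a.a32 - a.a1 - a.a23 ≤ 0)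
    {u v : Fin 4 →₀ ℕ} (h : a.IsRule u v) : NegDegRevLex v u := by
  have h21 := a.a21_pos
  have h41 := a.a41_pos
  have hd := a.two_le_d
  have e3 : a.a3 = a.a13 + a.a23 := rfl
  -- Each step in `i` raises the degree excess of `g_i` and `h_i` by `a_3 - a_32 - a_34 > 0`, so `i
  -- = d - 2`, covered by `c4` and `c5`, is the worst case.
  have hmono : ∀ i : ℕ, i ≤ a.d - 2 → ((i : ℤ) + 1) * (a.a3 - a.a32 - a.a34) ≤
      ((a.d : ℤ) - 1) * (a.a3 - a.a32 - a.a34) := fun i hi =>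
    mul_le_mul_of_nonneg_right (by omega) (by omega)
  cases h with
  | f2 => exact negDegRevLex_expVec (by omega) h21
  | f3 => exact negDegRevLex_expVec_of_lt (by omega)
  | f4 => exact negDegRevLex_expVec (by omega) h41
  | g i hi =>
    refine negDegRevLex_expVec ?_ h21
    obtain ⟨k, hk⟩ := Nat.exists_eq_add_of_le (a.mul_lt_of_lt_d (i := i + 1) (by omega)).1.le
    have h := hmono i hi
    rw [hk, Nat.add_sub_cancel_left]
    zify at hk e3 ⊢
    linarith
  | h i hi =>
    refine negDegRevLex_expVec ?_ (Nat.add_pos_left h21 _)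
    obtain ⟨k, hk⟩ := Nat.exists_eq_add_of_le (a.mul_lt_of_lt_d (i := i + 1) (by omega)).2.le
    have h := hmono i hi
    rw [hk, Nat.add_sub_cancel_left]
    zify at hk e3 ⊢
    linarith
  | p_of_lt hlt =>
    refine negDegRevLex_expVec ?_ h21
    obtain ⟨k, hk⟩ := Nat.exists_eq_add_of_le (a.d_mem.resolve_right hlt.not_ge)
    obtain ⟨e, he⟩ := Nat.exists_eq_add_of_le hd
    have h := c6 (by zify at hlt; linarith)
    rw [hk, Nat.add_sub_cancel_left]
    rw [he] at h hk ⊢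
    rw [show 2 + e - 1 = 1 + e by omega]
    zify at h hk e3 ⊢
    linarith
  | p_of_le hle =>
    refine negDegRevLex_expVec ?_ (Nat.add_pos_left h21 _)
    obtain ⟨k, hk⟩ := Nat.exists_eq_add_of_le hle
    obtain ⟨e, he⟩ := Nat.exists_eq_add_of_le hd
    have h := c7 (by zify at hle; linarith)
    rw [hk, Nat.add_sub_cancel_left]
    rw [he] at h hk ⊢
    rw [show 2 + e - 1 = 1 + e by omega]
    zify at h hk e3 ⊢
    linarith

/-- On exponent differences `g_i` is `f_2 + (i+1) f_3` and `h_i` is `f_2 + f_4 + (i+1) f_3`. The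
binomial `p` is the case `i = d - 1` of `g_i` or `h_i`, with the power whose exponent is no longer
positive moved to the other side. -/
theorem IsRule.weight_eq {n : Fin 4 → ℕ} (h2 : a.a2 * n 1 = a.a21 * n 0 + a.a23 * n 2)
    (h3 : a.a3 * n 2 = a.a32 * n 1 + a.a34 * n 3)
    (h4 : a.a4 * n 3 = a.a41 * n 0 + a.a42 * n 1)
    {u v : Fin 4 →₀ ℕ} (h : a.IsRule u v) : Finsupp.weight n u = Finsupp.weight n v := by
  have hd := a.two_le_d
  have e1 : a.a1 = a.a21 + a.a41 := rfl
  have e2 : a.a2 = a.a32 + a.a42 := rfl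
  have e3 : a.a3 = a.a13 + a.a23 := rfl
  cases h <;> rw [weight_expVec, weight_expVec]
  case f2 => linarith
  case f3 => linarith
  case f4 => linarith
  case g i hi =>
    obtain ⟨k, hk⟩ := Nat.exists_eq_add_of_le (a.mul_lt_of_lt_d (i := i + 1) (by omega)).1.le
    rw [hk, Nat.add_sub_cancel_left]
    zify at *
    linear_combination h2 + (i + 1) * h3 - n 1 * hk - n 2 * e3
  case h i hi =>
    obtain ⟨k, hk⟩ := Nat.exists_eq_add_of_le (a.mul_lt_of_lt_d (i := i + 1) (by omega)).2.le
    rw [hk, Nat.add_sub_cancel_left]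
    zify at *
    linear_combination h2 + h4 + (i + 1) * h3 - n 3 * hk - n 2 * e3 - n 0 * e1 - n 1 * e2
  case p_of_lt hlt =>
    obtain ⟨k, hk⟩ := Nat.exists_eq_add_of_le (a.d_mem.resolve_right hlt.not_ge)
    obtain ⟨e, he⟩ := Nat.exists_eq_add_of_le hd
    rw [hk, Nat.add_sub_cancel_left, show a.d - 1 = 1 + e by omega]
    zify at *
    linear_combination h2 + a.d * h3 + n 1 * hk - n 2 * e3 - a.a3 * n 2 * he
  case p_of_le hle =>
    obtain ⟨k, hk⟩ := Nat.exists_eq_add_of_le hle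
    obtain ⟨e, he⟩ := Nat.exists_eq_add_of_le hd
    rw [hk, Nat.add_sub_cancel_left, show a.d - 1 = 1 + e by omega]
    zify at *
    linear_combination h2 + h4 + a.d * h3 + n 3 * hk - n 2 * e3 - n 0 * e1 - n 1 * e2
      + (a.a32 * n 1 - a.a3 * n 2) * he

theorem IsRule.eq_of_le {u v u' v' : Fin 4 →₀ ℕ} (h : a.IsRule u v) (h' : a.IsRule u' v')
    (hle : u' ≤ u) : u = u' ∧ v = v' := by
  have hd := a.two_le_d
  have p13 := a.a13_pos
  have p14 := a.a14_pos
  have p23 := a.a23_pos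
  have p32 := a.a32_pos
  have p34 := a.a34_pos
  have p42 := a.a42_pos
  have e2 : a.a2 = a.a32 + a.a42 := rfl
  have e3 : a.a3 = a.a13 + a.a23 := rfl
  have e4 : a.a4 = a.a14 + a.a34 := rfl
  have hlt : ∀ i ≤ a.d - 2, (i + 1) * a.a32 < a.a2 ∧ (i + 1) * a.a34 < a.a4 :=
    fun i hi => a.mul_lt_of_lt_d (by omega)
  have h32 : ∀ i : ℕ, a.a32 ≤ (i + 1) * a.a32 := fun i => Nat.le_mul_of_pos_left _ i.succ_pos
  have h34 : ∀ i : ℕ, a.a34 ≤ (i + 1) * a.a34 := fun i => Nat.le_mul_of_pos_left _ i.succ_pos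
  have hp : ∀ i ≤ a.d - 2, i * a.a3 + a.a3 ≤ (a.d - 1) * a.a3 := fun i hi => by
    rw [← Nat.succ_mul]
    exact Nat.mul_le_mul_right _ (by omega)
  -- Within each family the exponent of `x_3` increases with `i` while the other exponent decreases,
  -- so divisibility forces equal indices.
  have hij : ∀ i j b c : ℕ, 0 < b → (i + 1) * b < c → c - (j + 1) * b ≤ c - (i + 1) * b →
      j * a.a3 + a.a13 ≤ i * a.a3 + a.a13 → i = j := by
    intro i j b c hb hc h₁ h₂
    have : j ≤ i := Nat.le_of_mul_le_mul_right (by omega) (show 0 < a.a3 by omega)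
    have : i + 1 ≤ j + 1 := Nat.le_of_mul_le_mul_right (by omega) hb
    omega
  cases h <;> cases h' <;> rw [expVec_le_iff] at hle <;>
    simp only [expVec_zero, expVec_one, expVec_two, expVec_three] at hle
  case g.g i hi j hj =>
    obtain rfl := hij i j _ _ p32 (hlt i hi).1 hle.2.1 hle.2.2.1
    exact ⟨rfl, rfl⟩
  case h.h i hi j hj =>
    obtain rfl := hij i j _ _ p34 (hlt i hi).2 hle.2.2.2 hle.2.2.1
    exact ⟨rfl, rfl⟩
  all_goals first
    | exact ⟨rfl, rfl⟩
    | omega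
    | (rename_i i hi
       have := hlt i hi
       have := h32 i
       have := h34 i
       have := hp i hi
       omega)
    | (rename_i i hi _
       have := hlt i hi
       have := hp i hi
       omega)

/-- Such a power of `x_3` rules out `i ≥ d - 1` because of `p`; then `g_i` and `h_i` bound the other
two exponents, as `a_2 - (i+1) a_32 = a_42 - i a_32` and `a_4 - (i+1) a_34 = a_14 - i a_34`. -/
theorem IsRule.lt_of_forall_not_le {u : Fin 4 →₀ ℕ} (hu : ∀ x y, a.IsRule x y → ¬ x ≤ u)
    {i : ℤ} (hi : 0 ≤ i) (h : i * a.a3 + a.a13 ≤ u 2) :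
    (u 1 : ℤ) < a.a42 - i * a.a32 ∧ (u 3 : ℤ) < a.a14 - i * a.a34 := by
  lift i to ℕ using hi
  have hd := a.two_le_d
  have h' : i * a.a3 + a.a13 ≤ u 2 := by exact_mod_cast h
  have hid : i ≤ a.d - 2 := by
    by_contra! hc
    have hle : (a.d - 1) * a.a3 ≤ i * a.a3 := Nat.mul_le_mul_right _ (by omega)
    rcases lt_or_ge (a.d * a.a34) a.a4 with h4 | h4
    · exact hu _ _ (.p_of_lt h4) ((expVec_le_iff ..).2 ⟨by simp, by simp, by omega, by simp⟩)
    · exact hu _ _ (.p_of_le h4) ((expVec_le_iff ..).2 ⟨by simp, by simp, by omega, by simp⟩)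
  have h1 := hu _ _ (.g i hid)
  have h2 := hu _ _ (.h i hid)
  rw [expVec_le_iff] at h1 h2
  have h1 : u 1 < a.a2 - (i + 1) * a.a32 := by
    by_contra! hc
    exact h1 ⟨by simp, hc, h', by simp⟩
  have h2 : u 3 < a.a4 - (i + 1) * a.a34 := by
    by_contra! hc
    exact h2 ⟨by simp, by simp, h', hc⟩
  rw [Nat.lt_sub_iff_add_lt] at h1 h2
  rw [a2] at h1
  rw [a4] at h2
  zify at h1 h2
  constructor <;> linarith

/-- If `β ≥ 1`, the bounds from `f_2`, `f_3`, `f_4` give `γ ≥ 0` and `0 < α ≤ β`. Then `u` is so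
divisible by `x_3` that `g_i` and `h_i` with `i = β - α` (or `p`) apply, and one of them is violated
according to whether `γ < α` or `γ ≥ α`. -/
theorem IsRule.coeff_nonpos_of_forall_not_le {u v : Fin 4 →₀ ℕ}
    (hu : ∀ x y, a.IsRule x y → ¬ x ≤ u) (hv : ∀ x y, a.IsRule x y → ¬ x ≤ v) {α β γ : ℤ}
    (e1 : (u 1 : ℤ) - v 1 = α * a.a2 - β * a.a32 - γ * a.a42)
    (e2 : (u 2 : ℤ) - v 2 = β * a.a3 - α * a.a23)
    (e3 : (u 3 : ℤ) - v 3 = γ * a.a4 - β * a.a34) : β ≤ 0 := by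
  by_contra! hβ
  have p13 : (0 : ℤ) < a.a13 := by exact_mod_cast a.a13_pos
  have p14 : (0 : ℤ) < a.a14 := by exact_mod_cast a.a14_pos
  have p23 : (0 : ℤ) < a.a23 := by exact_mod_cast a.a23_pos
  have p32 : (0 : ℤ) < a.a32 := by exact_mod_cast a.a32_pos
  have p34 : (0 : ℤ) < a.a34 := by exact_mod_cast a.a34_pos
  have p42 : (0 : ℤ) < a.a42 := by exact_mod_cast a.a42_pos
  have h1 : ∀ {w : Fin 4 →₀ ℕ}, (∀ x y, a.IsRule x y → ¬ x ≤ w) →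
      (w 1 : ℤ) < a.a32 + a.a42 := by
    intro w hw
    have := hw _ _ .f2
    simp only [expVec_le_iff, zero_le, true_and, and_true, not_le, a2] at this
    exact_mod_cast this
  have h3 : ∀ {w : Fin 4 →₀ ℕ}, (∀ x y, a.IsRule x y → ¬ x ≤ w) →
      (w 3 : ℤ) < a.a14 + a.a34 := by
    intro w hw
    have := hw _ _ .f4
    simp only [expVec_le_iff, zero_le, true_and, not_le, a4] at this
    exact_mod_cast this
  have hu1 := h1 hu
  have hv1 := h1 hv
  have hu3 := h3 hu
  have hv3 := h3 hv
  have h13 : (a.a34 : ℤ) ≤ v 3 → (v 1 : ℤ) < a.a32 := by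
    intro h
    have := hv _ _ .f3
    simp only [expVec_le_iff, zero_le, true_and, not_and, not_le] at this
    omega
  simp only [a2, a3, a4, Nat.cast_add] at e1 e2 e3
  have hβ34 : (a.a34 : ℤ) ≤ β * a.a34 := le_mul_of_one_le_left p34.le hβ
  have hβ32 : (a.a32 : ℤ) ≤ β * a.a32 := le_mul_of_one_le_left p32.le hβ
  have hγ : 0 ≤ γ := by
    by_contra! hγ
    have : γ * (a.a14 + a.a34) ≤ -1 * (a.a14 + a.a34) :=
      mul_le_mul_of_nonneg_right (by omega) (by omega)
    linarith
  have hγ42 : 0 ≤ γ * a.a42 := mul_nonneg hγ p42.le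
  have hα : 0 < α := by
    by_contra! hα
    have hα2 : α * (a.a32 + a.a42) ≤ 0 := mul_nonpos_of_nonpos_of_nonneg hα (by omega)
    rcases hγ.eq_or_lt with rfl | hγ
    · have := h13 (by linarith)
      linarith
    · have : (a.a42 : ℤ) ≤ γ * a.a42 := le_mul_of_one_le_left p42.le hγ
      linarith
  have hαβ : α ≤ β := by
    by_contra! hαβ
    have h₁ : 1 * (a.a32 : ℤ) ≤ (α - β) * a.a32 :=
      mul_le_mul_of_nonneg_right (by omega) p32.le
    have hγα : α ≤ γ := by
      by_contra! hγα
      have : 1 * (a.a42 : ℤ) ≤ (α - γ) * a.a42 :=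
        mul_le_mul_of_nonneg_right (by omega) p42.le
      linarith
    have : 1 * (a.a34 : ℤ) ≤ (γ - β) * a.a34 :=
      mul_le_mul_of_nonneg_right (by omega) p34.le
    have : 1 * (a.a14 : ℤ) ≤ γ * a.a14 := mul_le_mul_of_nonneg_right (by omega) p14.le
    linarith
  have hα13 : (a.a13 : ℤ) ≤ α * a.a13 := le_mul_of_one_le_left p13.le hα
  -- `e2` reads `u 2 = v 2 + (β - α) a_3 + α a_13`, and `α ≥ 1`.
  obtain ⟨k1, k3⟩ := lt_of_forall_not_le hu (i := β - α) (by omega)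
    (by simp only [a3, Nat.cast_add]; linarith)
  rcases lt_or_ge γ α with h | h
  · have : 1 * (a.a42 : ℤ) ≤ (α - γ) * a.a42 :=
      mul_le_mul_of_nonneg_right (by omega) p42.le
    linarith
  · have : 1 * (a.a14 : ℤ) ≤ γ * a.a14 := mul_le_mul_of_nonneg_right (by omega) p14.le
    have : α * (a.a34 : ℤ) ≤ γ * a.a34 := mul_le_mul_of_nonneg_right h p34.le
    linarith

theorem IsRule.eq_of_forall_not_le {u v : Fin 4 →₀ ℕ}
    (hu : ∀ x y, a.IsRule x y → ¬ x ≤ u) (hv : ∀ x y, a.IsRule x y → ¬ x ≤ v) {α β γ : ℤ}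
    (e0 : (u 0 : ℤ) - v 0 = -α * a.a21 - γ * a.a41)
    (e1 : (u 1 : ℤ) - v 1 = α * a.a2 - β * a.a32 - γ * a.a42)
    (e2 : (u 2 : ℤ) - v 2 = β * a.a3 - α * a.a23)
    (e3 : (u 3 : ℤ) - v 3 = γ * a.a4 - β * a.a34) : u = v := by
  have h₁ := coeff_nonpos_of_forall_not_le hu hv e1 e2 e3
  -- Exchanging `u` and `v` negates all three coefficients.
  have h₂ := coeff_nonpos_of_forall_not_le (α := -α) (β := -β) (γ := -γ) hv hu (by linarith)
    (by linarith) (by linarith)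
  obtain rfl : β = 0 := by omega
  have key : ∀ {c : ℤ} {x y A : ℕ}, x < A → y < A → (x : ℤ) - y = c * A → c = 0 := by
    intro c x y A hx hy h
    by_contra hc
    have : (1 : ℤ) ≤ |c| := Int.one_le_abs hc
    have h' : |(x : ℤ) - y| = |c| * A := by rw [h, abs_mul, Nat.abs_cast]
    have : |(x : ℤ) - y| < A := abs_sub_lt_iff.2 ⟨by omega, by omega⟩
    nlinarith
  have h1 : ∀ {w : Fin 4 →₀ ℕ}, (∀ x y, a.IsRule x y → ¬ x ≤ w) → w 1 < a.a2 := by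
    intro w hw
    simpa [expVec_le_iff] using hw _ _ .f2
  have h3 : ∀ {w : Fin 4 →₀ ℕ}, (∀ x y, a.IsRule x y → ¬ x ≤ w) → w 3 < a.a4 := by
    intro w hw
    simpa [expVec_le_iff] using hw _ _ .f4
  -- With `β = 0` the `x_4`-coordinate is `γ a_4`; only once `γ = 0` does the `x_2`-coordinate
  -- become `α a_2`.
  obtain rfl : γ = 0 := key (h3 hu) (h3 hv) (by linarith)
  obtain rfl : α = 0 := key (h1 hu) (h1 hv) (by linarith)
  ext i
  fin_cases i <;> simp at * <;> omega

end Lead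

/-! ### The elements of `T` as binomials, and the relation lattice of `G`. -/

section Binomials

open MvPolynomial

variable (K : Type*) [Field K]

/-- The binomial with exponents `u` and `v`, oriented as in `T`: only `f_3`, the one binomial
whose smaller monomial `x^v` does not involve `x_1`, has leading coefficient `-1`. -/
noncomputable def binomial (u v : Fin 4 →₀ ℕ) : MvPolynomial (Fin 4) K :=
  if v 0 = 0 then monomial v 1 - monomial u 1 else monomial u 1 - monomial v 1

variable {K} in
theorem isLeadingMonomial_binomial {u v m : Fin 4 →₀ ℕ} (h : NegDegRevLex v u) :
    IsLeadingMonomial NegDegRevLex (binomial K u v) m ↔ m = u := by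
  rw [← isLeadingMonomial_binomial_iff (K := K) h, binomial]
  split_ifs
  · rw [← neg_sub, IsLeadingMonomial, IsLeadingMonomial, support_neg]
  · rfl

theorem binomial_mem_toricIdeal {n : Fin 4 → ℕ} {u v : Fin 4 →₀ ℕ}
    (h : Finsupp.weight n u = Finsupp.weight n v) : binomial K u v ∈ toricIdeal K n := by
  rw [binomial]
  split_ifs
  · exact (binomial_mem_toricIdeal_iff n v u).2 h.symm
  · exact (binomial_mem_toricIdeal_iff n u v).2 h

theorem f2_eq : a.f2 K = monomial (expVec 0 a.a2 0 0) 1 - monomial (expVec a.a21 0 a.a23 0) 1 := by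
  simp [f2, monomial_expVec]

theorem f3_eq : a.f3 K = monomial (expVec 0 0 a.a3 0) 1 - monomial (expVec 0 a.a32 0 a.a34) 1 := by
  simp [f3, monomial_expVec]

theorem f4_eq : a.f4 K = monomial (expVec 0 0 0 a.a4) 1 - monomial (expVec a.a41 a.a42 0 0) 1 := by
  simp [f4, monomial_expVec]

theorem g_eq (i : ℕ) :
    a.g K i = monomial (expVec 0 (a.a2 - (i + 1) * a.a32) (i * a.a3 + a.a13) 0) 1 -
      monomial (expVec a.a21 0 0 ((i + 1) * a.a34)) 1 := by
  simp [g, monomial_expVec]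

theorem h_eq (i : ℕ) :
    a.h K i = monomial (expVec 0 0 (i * a.a3 + a.a13) (a.a4 - (i + 1) * a.a34)) 1 -
      monomial (expVec a.a1 (i * a.a32) 0 0) 1 := by
  simp [h, monomial_expVec]

theorem p_eq_of_lt (hd : a.d * a.a34 < a.a4) :
    a.p K = monomial (expVec 0 0 ((a.d - 1) * a.a3 + a.a13) 0) 1 -
      monomial (expVec a.a21 (a.d * a.a32 - a.a2) 0 (a.d * a.a34)) 1 := by
  rw [p, if_pos (by zify at hd; linarith)]
  simp [monomial_expVec]

theorem p_eq_of_le (hd : a.a4 ≤ a.d * a.a34) :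
    a.p K = monomial (expVec 0 0 ((a.d - 1) * a.a3 + a.a13) 0) 1 -
      monomial (expVec a.a1 ((a.d - 1) * a.a32) 0 (a.d * a.a34 - a.a4)) 1 := by
  rw [p, if_neg (by zify at hd; linarith)]
  simp [monomial_expVec]

theorem f1_eq_h : a.f1 K = a.h K 0 := by
  simp [f1, h, a4]

theorem f5_eq_g : a.f5 K = a.g K 0 := by
  simp [f5, g, a2]

theorem mem_T_iff {q : MvPolynomial (Fin 4) K} :
    q ∈ a.T K ↔ ∃ u v, a.IsRule u v ∧ q = binomial K u v := by
  have h21 := a.a21_pos.ne'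
  have h41 := a.a41_pos.ne'
  have h1 : a.a1 ≠ 0 := by rw [a1]; omega
  constructor
  · rintro ((((rfl | rfl | rfl | rfl | rfl) | ⟨i, -, hi, rfl⟩) | ⟨i, -, hi, rfl⟩) | rfl)
    · exact ⟨_, _, .h 0 (Nat.zero_le _), by rw [f1_eq_h, h_eq, binomial, if_neg (by simpa)]⟩
    · exact ⟨_, _, .f2, by rw [f2_eq, binomial, if_neg (by simpa)]⟩
    · exact ⟨_, _, .f3, by rw [f3_eq, binomial, if_pos (by simp)]⟩
    · exact ⟨_, _, .f4, by rw [f4_eq, binomial, if_neg (by simpa)]⟩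
    · exact ⟨_, _, .g 0 (Nat.zero_le _), by rw [f5_eq_g, g_eq, binomial, if_neg (by simpa)]⟩
    · exact ⟨_, _, .g i hi, by rw [g_eq, binomial, if_neg (by simpa)]⟩
    · exact ⟨_, _, .h i hi, by rw [h_eq, binomial, if_neg (by simpa)]⟩
    · rcases lt_or_ge (a.d * a.a34) a.a4 with hd | hd
      · exact ⟨_, _, .p_of_lt hd, by rw [p_eq_of_lt _ _ hd, binomial, if_neg (by simpa)]⟩
      · exact ⟨_, _, .p_of_le hd, by rw [p_eq_of_le _ _ hd, binomial, if_neg (by simpa)]⟩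
  · rintro ⟨u, v, hR, rfl⟩
    cases hR with
    | f2 =>
      rw [binomial, if_neg (by simpa), ← f2_eq]
      simp [T, G]
    | f3 =>
      rw [binomial, if_pos (by simp), ← f3_eq]
      simp [T, G]
    | f4 =>
      rw [binomial, if_neg (by simpa), ← f4_eq]
      simp [T, G]
    | g i hi =>
      rw [binomial, if_neg (by simpa), ← g_eq]
      rcases i.eq_zero_or_pos with rfl | h0
      · rw [← f5_eq_g]
        simp [T, G]
      · exact Or.inl (Or.inl (Or.inr ⟨i, h0, hi, rfl⟩))
    | h i hi =>
      rw [binomial, if_neg (by simpa), ← h_eq]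
      rcases i.eq_zero_or_pos with rfl | h0
      · rw [← f1_eq_h]
        simp [T, G]
      · exact Or.inl (Or.inr ⟨i, h0, hi, rfl⟩)
    | p_of_lt hd =>
      rw [binomial, if_neg (by simpa), ← p_eq_of_lt _ _ hd]
      simp [T]
    | p_of_le hd =>
      rw [binomial, if_neg (by simpa), ← p_eq_of_le _ _ hd]
      simp [T]

theorem finite_T : (a.T K).Finite := by
  have hfin : ∀ φ : ℕ → MvPolynomial (Fin 4) K,
      {q | ∃ i, 1 ≤ i ∧ i ≤ a.d - 2 ∧ q = φ i}.Finite := fun φ =>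
    ((Set.finite_Iic (a.d - 2)).image φ).subset fun q ⟨i, _, hi, hq⟩ => ⟨i, hi, hq.symm⟩
  have hG : (a.G K).Finite := by simp [G]
  exact ((hG.union (hfin _)).union (hfin _)).union (Set.finite_singleton _)

/-- The lattice generated by the exponent differences of `f_2`, `f_3` and `f_4`. -/
def relationLattice : AddSubgroup (Fin 4 → ℤ) where
  carrier := {w | ∃ α β γ : ℤ, w 0 = -α * a.a21 - γ * a.a41 ∧
    w 1 = α * a.a2 - β * a.a32 - γ * a.a42 ∧ w 2 = β * a.a3 - α * a.a23 ∧
    w 3 = γ * a.a4 - β * a.a34}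
  zero_mem' := ⟨0, 0, 0, by simp⟩
  add_mem' := by
    rintro w w' ⟨α, β, γ, h0, h1, h2, h3⟩ ⟨α', β', γ', h0', h1', h2', h3'⟩
    refine ⟨α + α', β + β', γ + γ', ?_⟩
    simp only [Pi.add_apply, h0, h1, h2, h3, h0', h1', h2', h3']
    refine ⟨?_, ?_, ?_, ?_⟩ <;> ring
  neg_mem' := by
    rintro w ⟨α, β, γ, h0, h1, h2, h3⟩
    refine ⟨-α, -β, -γ, ?_⟩
    simp only [Pi.neg_apply, h0, h1, h2, h3]
    refine ⟨?_, ?_, ?_, ?_⟩ <;> ring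

theorem mem_relationLattice_iff {w : Fin 4 → ℤ} :
    w ∈ a.relationLattice ↔ ∃ α β γ : ℤ, w 0 = -α * a.a21 - γ * a.a41 ∧
      w 1 = α * a.a2 - β * a.a32 - γ * a.a42 ∧ w 2 = β * a.a3 - α * a.a23 ∧
      w 3 = γ * a.a4 - β * a.a34 :=
  Iff.rfl

theorem sub_mem_relationLattice {n : Fin 4 → ℕ} (hG : toricIdeal K n = Ideal.span (a.G K))
    {u v : Fin 4 →₀ ℕ} (h : Finsupp.weight n u = Finsupp.weight n v) :
    (fun i => (u i : ℤ) - v i) ∈ a.relationLattice := by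
  refine sub_mem_of_weight_eq hG _ ?_ h
  rintro q (rfl | rfl | rfl | rfl | rfl)
  · refine ⟨_, _, ?_, (a.f1_eq_h K).trans (a.h_eq K 0)⟩
    -- On exponent differences `f_1 = f_2 + f_3 + f_4`, and below `f_5 = f_2 + f_3`.
    exact a.mem_relationLattice_iff.2 ⟨1, 1, 1, by simp [a1, a2, a3, a4]; ring⟩
  · refine ⟨_, _, ?_, a.f2_eq K⟩
    exact a.mem_relationLattice_iff.2 ⟨1, 0, 0, by simp⟩
  · refine ⟨_, _, ?_, a.f3_eq K⟩
    exact a.mem_relationLattice_iff.2 ⟨0, 1, 0, by simp⟩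
  · refine ⟨_, _, ?_, a.f4_eq K⟩
    exact a.mem_relationLattice_iff.2 ⟨0, 0, 1, by simp⟩
  · refine ⟨_, _, ?_, (a.f5_eq_g K).trans (a.g_eq K 0)⟩
    exact a.mem_relationLattice_iff.2 ⟨1, 1, 0, by simp [a2, a3]⟩

end Binomials

end CurveExponents

/-! ### The minimal standard basis. -/

theorem proposition2p5 {K : Type*} [Field K] (n : Fin 4 → ℕ) (a : CurveExponents)
    (n_pos : ∀ i, 0 < n i) (n_distinct : Function.Injective n)
    (n_gcd : Finset.univ.gcd n = 1)
    (hG : toricIdeal K n = Ideal.span (a.G K))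
    (n_min : ∀ i, n 0 ≤ n i)
    (h3 : a.a3 > a.a32 + a.a34)
    (c1 : a.a2 ≤ a.a21 + a.a23)
    (c2 : a.a4 ≤ a.a41 + a.a42)
    (c3 : a.a42 + a.a13 ≤ a.a21 + a.a34)
    (c4 : ((a.d : ℤ) - 1) * (a.a3 - a.a32 - a.a34) + a.a2 - a.a21 - a.a23 ≤ 0)
    (c5 : ((a.d : ℤ) - 1) * (a.a3 - a.a32 - a.a34) + a.a4 + a.a32 - a.a1 - a.a23 ≤ 0)
    (c6 : (a.a4 : ℤ) - a.d * a.a34 > 0 →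
      (a.d : ℤ) * (a.a3 - a.a32 - a.a34) + a.a2 - a.a21 - a.a23 ≤ 0)
    (c7 : (a.a4 : ℤ) - a.d * a.a34 ≤ 0 →
      (a.d : ℤ) * (a.a3 - a.a32 - a.a34) + a.a4 + a.a32 - a.a1 - a.a23 ≤ 0) :
    IsMinimalStandardBasis NegDegRevLex (toricIdeal K n) (a.T K) := by
  have hmem : ∀ q ∈ a.G K, q ∈ toricIdeal K n := fun q hq => hG ▸ Ideal.subset_span hq
  have w2 : a.a2 * n 1 = a.a21 * n 0 + a.a23 * n 2 := by
    have h := hmem (a.f2 K) (by simp [CurveExponents.G])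
    rw [a.f2_eq, binomial_mem_toricIdeal_iff] at h
    simpa [weight_expVec] using h
  have w3 : a.a3 * n 2 = a.a32 * n 1 + a.a34 * n 3 := by
    have h := hmem (a.f3 K) (by simp [CurveExponents.G])
    rw [a.f3_eq, binomial_mem_toricIdeal_iff] at h
    simpa [weight_expVec] using h
  have w4 : a.a4 * n 3 = a.a41 * n 0 + a.a42 * n 1 := by
    have h := hmem (a.f4 K) (by simp [CurveExponents.G])
    rw [a.f4_eq, binomial_mem_toricIdeal_iff] at h
    simpa [weight_expVec] using h
  have hlt : ∀ u v, a.IsRule u v → NegDegRevLex v u := fun u v h =>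
    h.negDegRevLex h3 c1 c2 c4 c5 c6 c7
  have hw : ∀ u v, a.IsRule u v → Finsupp.weight n u = Finsupp.weight n v := fun u v h =>
    h.weight_eq w2 w3 w4
  have hLM : ∀ u v, a.IsRule u v →
      IsLeadingMonomial NegDegRevLex (CurveExponents.binomial K u v) u := fun u v h =>
    (CurveExponents.isLeadingMonomial_binomial (hlt u v h)).2 rfl
  have hTI : a.T K ⊆ toricIdeal K n := fun q hq => by
    obtain ⟨u, v, hR, rfl⟩ := (a.mem_T_iff K).1 hq
    exact CurveExponents.binomial_mem_toricIdeal K (hw u v hR)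
  refine ⟨⟨a.finite_T K, hTI, le_antisymm ?_ ?_⟩, ?_, ?_⟩
  · exact Ideal.span_mono fun q ⟨f, hf, hm⟩ => ⟨f, hTI hf, hm⟩
  · refine leadingIdeal_toricIdeal_le n_pos (R := a.IsRule)
      (fun u v h => ⟨_, (a.mem_T_iff K).2 ⟨u, v, h, rfl⟩, hLM u v h⟩) hlt hw ?_
    intro u v huv hu hv
    obtain ⟨α, β, γ, e0, e1, e2, e3⟩ := a.mem_relationLattice_iff.1
      (a.sub_mem_relationLattice K hG huv)
    exact CurveExponents.IsRule.eq_of_forall_not_le hu hv e0 e1 e2 e3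
  · intro h0
    obtain ⟨u, v, hR, h⟩ := (a.mem_T_iff K).1 h0
    have := (hLM u v hR).1
    simp [← h] at this
  · intro f hf g hg hfg m m' hm hm' hdvd
    obtain ⟨u, v, hR, rfl⟩ := (a.mem_T_iff K).1 hf
    obtain ⟨u', v', hR', rfl⟩ := (a.mem_T_iff K).1 hg
    rw [CurveExponents.isLeadingMonomial_binomial (hlt _ _ hR)] at hm
    rw [CurveExponents.isLeadingMonomial_binomial (hlt _ _ hR')] at hm'
    subst hm hm'
    rw [MvPolynomial.monomial_dvd_monomial] at hdvd
    obtain ⟨rfl, rfl⟩ := hR.eq_of_le hR' (hdvd.1.resolve_left one_ne_zero)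
    exact hfg rfl
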